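/- Let $\mathcal F_{op}$ be the set of functions $f\colon(0,\infty)\to(0,\infty)$ that are operator monotone (that is, $A\le B$ implies $f(A)\le f(B)$ for positive definite matrices $A,B$ of any order) and satisfy $f(t)=t f(t^{-1})$ for all $t>0$ and $f(1)=1$. Such an $f$ extends continuously to $[0,\infty)$, and $f$ is called regular if $f(0)>0$. The associated Morozova-Chentsov function is $c(x,y)=\dfrac{1}{y f(xy^{-1})}$ for $x,y>0$. For a positive definite density operator $\rho$ on a finite-dimensional complex Hilbert space and an operator $A$ on that space put $$K^c_\rho(A,B)=\operatorname{Tr}A^*c(L_\rho,R_\rho)B,\qquad I^c_\rho(A)=\frac{f(0)}{2}\,K^c_\rho\big(i[\rho,A],i[\rho,A]\big),$$ where $L_\rho$ and $R_\rho$ are the (commuting, positive definite) operators of left and right multiplication by $\rho$. For regular $f$ in $\mathcal F_{op}$ the metric adjusted skew information $\rho\mapsto I^c_\rho(A)$ extends by continuity to all (positive semi-definite) density operators $\rho$, and the extension is denoted by the same symbol. **Lemma.** Let $f$ be a regular function in $\mathcal F_{op}$ and let $c$ be the associated Morozova-Chentsov function. Let $H_1,H_2$ be finite-dimensional complex Hilbert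 spaces, let $\rho$ be a (not necessarily invertible) density operator on $H_1\otimes H_2$, and let $A$ be a self-adjoint operator on $H_1$. Then $$I^c_\rho(A\otimes \mathbf 1_2)\ \ge\ I^c_{\rho_1}(A),$$ where $\rho_1=\operatorname{Tr}_2\rho$ is the partial trace of $\rho$ over $H_2$. -/

import Mathlib

open Matrix Filter Topology
open scoped Kronecker ComplexOrder

namespace MetricSkew

/-- `f : (0,∞) → ℝ` is operator monotone: `A ≤ B` implies `f(A) ≤ f(B)` for positive definite
matrices `A`, `B` of every order.  Values of `f` outside `(0,∞)` play no role. -/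
def OperatorMonotone (f : ℝ → ℝ) : Prop :=
  ∀ (k : ℕ) (A B : Matrix (Fin k) (Fin k) ℂ), A.PosDef → B.PosDef →
    (B - A).PosSemidef → (cfc f B - cfc f A).PosSemidef

/-- The class `F_op` of functions `f : (0,∞) → (0,∞)`. -/
structure IsFop (f : ℝ → ℝ) : Prop where
  pos : ∀ t, 0 < t → 0 < f t
  operatorMonotone : OperatorMonotone f
  symm : ∀ t, 0 < t → f t = t * f t⁻¹
  map_one : f 1 = 1

/-- The value at `0` of the continuous extension of `f` from `(0,∞)` to `[0,∞)`; this is also the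
metric constant `m(c)` of the associated Morozova-Chentsov function. -/
noncomputable def valueAtZero (f : ℝ → ℝ) : ℝ := extendFrom (Set.Ioi 0) f 0

/-- `f` is regular if `f(0) > 0`. -/
def RegularAtZero (f : ℝ → ℝ) : Prop := 0 < valueAtZero f

/-- The Morozova-Chentsov function `c(x,y) = 1 / (y f(x y⁻¹))`, for `x, y > 0`. -/
noncomputable def morozovaChentsov (f : ℝ → ℝ) (x y : ℝ) : ℝ := 1 / (y * f (x * y⁻¹))

section
variable {n : Type*} [Fintype n] [DecidableEq n]

/-- The spectral projection of a Hermitian matrix `ρ` for the real number `x`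
(it is `0` if `x` is not an eigenvalue). -/
noncomputable def spectralProj (ρ : Matrix n n ℂ) (x : ℝ) : Matrix n n ℂ :=
  cfc (fun t : ℝ => if t = x then (1 : ℝ) else 0) ρ

/-- The joint functional calculus `g(L_ρ, R_ρ)` of the commuting operators `L_ρ : X ↦ ρ X` and
`R_ρ : X ↦ X ρ`, for Hermitian `ρ`: the sum of `g(x,y) L_{P_x} R_{P_y}` over the eigenvalues
`x, y` of `ρ`, where `L_{P_x}` and `R_{P_y}` are the spectral projections of `L_ρ` and `R_ρ`. -/
noncomputable def funLR (g : ℝ → ℝ → ℝ) (ρ : Matrix n n ℂ) : Matrix n n ℂ →ₗ[ℂ] Matrix n n ℂ :=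
  ∑ x ∈ (Matrix.finite_real_spectrum (A := ρ)).toFinset,
    ∑ y ∈ (Matrix.finite_real_spectrum (A := ρ)).toFinset,
      ((g x y : ℝ) : ℂ) • (LinearMap.mulLeft ℂ (spectralProj ρ x) ∘ₗ
        LinearMap.mulRight ℂ (spectralProj ρ y))

/-- The metric `K_ρ^c(A,B) = Tr A* c(L_ρ,R_ρ) B`. -/
noncomputable def metricK (f : ℝ → ℝ) (ρ A B : Matrix n n ℂ) : ℂ :=
  (Aᴴ * funLR (morozovaChentsov f) ρ B).trace

/-- Density matrices. -/
def IsDensity (ρ : Matrix n n ℂ) : Prop := ρ.PosSemidef ∧ ρ.trace = 1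

/-- The state manifold: positive definite density matrices. -/
def stateManifold (n : Type*) [Fintype n] [DecidableEq n] : Set (Matrix n n ℂ) :=
  {ρ | ρ.PosDef ∧ ρ.trace = 1}

/-- Metric adjusted skew information `(m(c)/2) K_ρ^c(i[ρ,A], i[ρ,A])` on the state manifold. -/
noncomputable def skewInformationManifold (f : ℝ → ℝ) (ρ A : Matrix n n ℂ) : ℝ :=
  valueAtZero f / 2 * (metricK f ρ (Complex.I • ⁅ρ, A⁆) (Complex.I • ⁅ρ, A⁆)).re

/-- Metric adjusted skew information `I_ρ^c(A)` of an arbitrary density matrix `ρ`: the extension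
by continuity from the state manifold.  For regular `f` in `F_op` the limit exists at every
density matrix (`tendsto_skewInformation`), and on the state manifold it gives back the original
value (`skewInformation_eq`). -/
noncomputable def skewInformation (f : ℝ → ℝ) (ρ A : Matrix n n ℂ) : ℝ :=
  extendFrom (stateManifold n) (fun σ => skewInformationManifold f σ A) ρ

end

/-- The partial trace over the second factor. -/
def partialTrace₂ {m n : Type*} [Fintype n] (ρ : Matrix (m × n) (m × n) ℂ) : Matrix m m ℂ :=
  Matrix.of fun i j => ∑ k, ρ (i, k) (j, k)

/-! Well-definedness of the extension. -/

theorem IsFop.monotoneOn {f : ℝ → ℝ} (hf : IsFop f) : MonotoneOn f (Set.Ioi 0) := by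
  intro a ha b hb hab
  have hpd : ∀ t : ℝ, 0 < t → (algebraMap ℝ (Matrix (Fin 1) (Fin 1) ℂ) t).PosDef := by
    intro t ht
    rw [Matrix.algebraMap_eq_diagonal]
    refine Matrix.PosDef.diagonal fun i => ?_
    simpa using ht
  have h := hf.operatorMonotone 1 (algebraMap ℝ _ a) (algebraMap ℝ _ b) (hpd a ha) (hpd b hb) ?_
  · rw [cfc_algebraMap, cfc_algebraMap, ← map_sub, Matrix.algebraMap_eq_diagonal,
      Matrix.posSemidef_diagonal_iff] at h
    have h0 := h 0
    simpa using h0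
  · rw [← map_sub, Matrix.algebraMap_eq_diagonal, Matrix.posSemidef_diagonal_iff]
    intro i
    have : (0:ℂ) ≤ ((b - a : ℝ) : ℂ) := by exact_mod_cast sub_nonneg.mpr hab
    simpa using this

theorem IsFop.tendsto_zero {f : ℝ → ℝ} (hf : IsFop f) :
    Tendsto f (𝓝[>] 0) (𝓝 (valueAtZero f)) := by
  refine tendsto_extendFrom ⟨_, MonotoneOn.tendsto_nhdsGT hf.monotoneOn ?_⟩
  refine ⟨0, ?_⟩
  rintro _ ⟨t, ht, rfl⟩
  exact (hf.pos t ht).le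

theorem IsFop.valueAtZero_le {f : ℝ → ℝ} (hf : IsFop f) {t : ℝ} (ht : 0 < t) :
    valueAtZero f ≤ f t := by
  refine le_of_tendsto hf.tendsto_zero ?_
  filter_upwards [Ioo_mem_nhdsGT ht] with s hs
  exact hf.monotoneOn hs.1 ht hs.2.le

theorem IsFop.continuousAt {f : ℝ → ℝ} (hf : IsFop f) {t : ℝ} (ht : 0 < t) :
    ContinuousAt f t := by
  -- `f` is squeezed between `min 1 (s/t) * f t` and `max 1 (s/t) * f t`
  have hanti : ∀ a b, 0 < a → a ≤ b → f b * a ≤ f a * b := by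
    intro a b ha hab
    have hb := ha.trans_le hab
    have h := hf.monotoneOn (inv_pos.mpr hb) (inv_pos.mpr ha) (inv_anti₀ ha hab)
    rw [hf.symm a ha, hf.symm b hb]
    nlinarith [mul_pos ha hb]
  have hft := hf.pos t ht
  have e1 : Tendsto (fun s => min 1 (s / t) * f t) (𝓝 t) (𝓝 (f t)) := by
    have : ContinuousAt (fun s => min 1 (s / t) * f t) t := by fun_prop
    simpa [ContinuousAt, ht.ne'] using this
  have e2 : Tendsto (fun s => max 1 (s / t) * f t) (𝓝 t) (𝓝 (f t)) := by
    have : ContinuousAt (fun s => max 1 (s / t) * f t) t := by fun_prop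
    simpa [ContinuousAt, ht.ne'] using this
  refine tendsto_of_tendsto_of_tendsto_of_le_of_le' e1 e2 ?_ ?_ <;>
  filter_upwards [Ioi_mem_nhds ht] with s hs <;>
  rcases le_total s t with h | h
  · have := hanti s t hs h
    refine (mul_le_mul_of_nonneg_right (min_le_right _ _) hft.le).trans ?_
    rw [div_mul_eq_mul_div, div_le_iff₀ ht]; linarith
  · refine (mul_le_mul_of_nonneg_right (min_le_left _ _) hft.le).trans ?_
    simpa using hf.monotoneOn ht hs h
  · refine le_trans ?_ (mul_le_mul_of_nonneg_right (le_max_left _ _) hft.le)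
    simpa using hf.monotoneOn hs ht h
  · have := hanti t s ht h
    refine le_trans ?_ (mul_le_mul_of_nonneg_right (le_max_right _ _) hft.le)
    rw [div_mul_eq_mul_div, le_div_iff₀ ht]; linarith

/-- The continuous extension of `f` to `ℝ`, constant on `(-∞,0]`. -/
noncomputable def extendedFun (f : ℝ → ℝ) (t : ℝ) : ℝ := if t ≤ 0 then valueAtZero f else f t

theorem IsFop.continuous_extendedFun {f : ℝ → ℝ} (hf : IsFop f) :
    Continuous (extendedFun f) := by
  rw [continuous_iff_continuousAt]
  intro t
  rcases lt_trichotomy t 0 with h | h | h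
  · refine (continuousAt_const (y := valueAtZero f)).congr ?_
    filter_upwards [Iio_mem_nhds h] with s hs
    exact (if_pos (le_of_lt hs)).symm
  · subst h
    rw [continuousAt_iff_continuous_left'_right']
    constructor
    · refine (continuousWithinAt_const (b := valueAtZero f)).congr ?_ ?_
      · intro s hs; exact if_pos (le_of_lt hs)
      · exact if_pos le_rfl
    · unfold ContinuousWithinAt
      have : extendedFun f 0 = valueAtZero f := if_pos le_rfl
      rw [this]
      refine hf.tendsto_zero.congr' ?_
      filter_upwards [self_mem_nhdsWithin] with s hs
      exact (if_neg (not_le.mpr hs)).symm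
  · refine (hf.continuousAt h).congr ?_
    filter_upwards [Ioi_mem_nhds h] with s hs
    exact (if_neg (not_le.mpr hs)).symm

/-- The continuous extension of `(x-y)² c(x,y)` from `(0,∞)²`. -/
noncomputable def cHat (f : ℝ → ℝ) (x y : ℝ) : ℝ :=
  (max x 0 - max y 0) ^ 2 / (max (max x 0) (max y 0) *
    extendedFun f (min (max x 0) (max y 0) / max (max x 0) (max y 0)))

theorem IsFop.valueAtZero_le_extendedFun {f : ℝ → ℝ} (hf : IsFop f) (t : ℝ) :
    valueAtZero f ≤ extendedFun f t := by
  unfold extendedFun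
  split_ifs with h
  · exact le_rfl
  · exact hf.valueAtZero_le (not_le.mp h)

theorem cHat_eq {f : ℝ → ℝ} (hf : IsFop f) {x y : ℝ} (hx : 0 < x) (hy : 0 < y) :
    (x - y) ^ 2 * morozovaChentsov f x y = cHat f x y := by
  unfold cHat morozovaChentsov extendedFun
  rw [max_eq_left hx.le, max_eq_left hy.le, mul_one_div]
  rcases le_total x y with h | h
  · rw [max_eq_right h, min_eq_left h, if_neg (not_le.mpr (div_pos hx hy)), div_eq_mul_inv x y]
  · rw [max_eq_left h, min_eq_right h, if_neg (not_le.mpr (div_pos hy hx)),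
      hf.symm (x * y⁻¹) (by positivity), mul_inv, inv_inv, mul_comm x⁻¹ y, ← div_eq_mul_inv y x]
    congr 1
    field_simp

theorem IsFop.continuous_cHat {f : ℝ → ℝ} (hf : IsFop f) (hreg : RegularAtZero f) :
    Continuous (fun p : ℝ × ℝ => cHat f p.1 p.2) := by
  have hr : 0 < valueAtZero f := hreg
  have hcont := hf.continuous_extendedFun
  rw [continuous_iff_continuousAt]
  intro p
  have hM0 : 0 ≤ max (max p.1 0) (max p.2 0) := le_max_of_le_left (le_max_right _ _)
  rcases hM0.eq_or_lt with h | h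
  · have h0 : cHat f p.1 p.2 = 0 := by
      unfold cHat; rw [← h]; simp
    unfold ContinuousAt
    dsimp only
    rw [h0]
    have hb : Tendsto (fun q : ℝ × ℝ => max (max q.1 0) (max q.2 0) / valueAtZero f)
        (𝓝 p) (𝓝 0) := by
      have : ContinuousAt (fun q : ℝ × ℝ => max (max q.1 0) (max q.2 0) / valueAtZero f) p := by
        fun_prop
      unfold ContinuousAt at this
      dsimp only at this
      rwa [← h, zero_div] at this
    refine tendsto_of_tendsto_of_tendsto_of_le_of_le tendsto_const_nhds hb ?_ ?_
    · intro q
      unfold cHat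
      have := hf.valueAtZero_le_extendedFun
        (min (max q.1 0) (max q.2 0) / max (max q.1 0) (max q.2 0))
      have h2 : 0 ≤ max (max q.1 0) (max q.2 0) := le_max_of_le_left (le_max_right _ _)
      exact div_nonneg (sq_nonneg _) (mul_nonneg h2 (hr.le.trans this))
    · intro q
      unfold cHat
      dsimp only
      have h1 := hf.valueAtZero_le_extendedFun
        (min (max q.1 0) (max q.2 0) / max (max q.1 0) (max q.2 0))
      set a := max q.1 0
      set b := max q.2 0
      have ha : 0 ≤ a := le_max_right _ _
      have hb' : 0 ≤ b := le_max_right _ _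
      have h2 : 0 ≤ max a b := le_max_of_le_left ha
      rcases h2.eq_or_lt with h3 | h3
      · rw [← h3]; simp
      · have h4 : (a - b) ^ 2 ≤ max a b * max a b := by
          rcases le_total a b with h | h
          · rw [max_eq_right h]; nlinarith
          · rw [max_eq_left h]; nlinarith
        rw [div_le_div_iff₀ (mul_pos h3 (hr.trans_le h1)) hr]
        calc (a - b) ^ 2 * valueAtZero f ≤ (max a b * max a b) * valueAtZero f := by gcongr
          _ ≤ (max a b * max a b) * extendedFun f (min a b / max a b) := by gcongr
          _ = _ := by ring
  · have hne : max (max p.1 0) (max p.2 0) *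
        extendedFun f (min (max p.1 0) (max p.2 0) / max (max p.1 0) (max p.2 0)) ≠ 0 :=
      (mul_pos h (hr.trans_le (hf.valueAtZero_le_extendedFun _))).ne'
    unfold cHat
    have hd : ContinuousAt (fun q : ℝ × ℝ =>
        min (max q.1 0) (max q.2 0) / max (max q.1 0) (max q.2 0)) p :=
      ContinuousAt.div (by fun_prop) (by fun_prop) h.ne'
    have he : ContinuousAt (fun q : ℝ × ℝ => extendedFun f
        (min (max q.1 0) (max q.2 0) / max (max q.1 0) (max q.2 0))) p :=
      hcont.continuousAt.comp_of_eq hd rfl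
    exact ContinuousAt.div (by fun_prop) (ContinuousAt.mul (by fun_prop) he) hne

section
variable {n : Type*} [Fintype n] [DecidableEq n]

theorem spectrum_conj_diagonal (U : unitary (Matrix n n ℂ)) (d : n → ℝ) :
    spectrum ℝ ((U : Matrix n n ℂ) * diagonal (fun i => (d i : ℂ)) * (U : Matrix n n ℂ)ᴴ) =
      Set.range d := by
  rw [← spectrum.preimage_algebraMap ℂ, ← star_eq_conjTranspose,
    Unitary.spectrum_star_right_conjugate, spectrum_diagonal]
  ext x
  simp

theorem cfc_conj_diagonal (U : unitary (Matrix n n ℂ)) (d : n → ℝ) (g : ℝ → ℝ) :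
    cfc g ((U : Matrix n n ℂ) * diagonal (fun i => (d i : ℂ)) * (U : Matrix n n ℂ)ᴴ) =
      (U : Matrix n n ℂ) * diagonal (fun i => (g (d i) : ℂ)) * (U : Matrix n n ℂ)ᴴ := by
  have hsa : IsSelfAdjoint
      ((U : Matrix n n ℂ) * diagonal (fun i => (d i : ℂ)) * (U : Matrix n n ℂ)ᴴ) := by
    rw [isSelfAdjoint_iff, star_eq_conjTranspose]
    simp [conjTranspose_mul, diagonal_conjTranspose, Matrix.mul_assoc, Pi.star_def]
  let p : Polynomial ℝ := Lagrange.interpolate (Finset.univ.image d) id g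
  have hp : ∀ i, p.eval (d i) = g (d i) := fun i =>
    Lagrange.eval_interpolate_at_node (v := id) g (Function.injective_id.injOn)
      (Finset.mem_image_of_mem d (Finset.mem_univ i))
  let φ : (n → ℝ) →ₐ[ℝ] Matrix n n ℂ :=
    ((Unitary.conjStarAlgAut ℝ (Matrix n n ℂ) U : Matrix n n ℂ ≃⋆ₐ[ℝ] Matrix n n ℂ) :
      Matrix n n ℂ →ₐ[ℝ] Matrix n n ℂ).comp
      ((diagonalAlgHom ℝ).comp (Complex.ofRealAm.compLeft n))
  have hφ : ∀ e : n → ℝ, φ e =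
      (U : Matrix n n ℂ) * diagonal (fun i => (e i : ℂ)) * (U : Matrix n n ℂ)ᴴ := by
    intro e
    rfl
  have h1 : cfc g (φ d) = cfc p.eval (φ d) := by
    refine cfc_congr ?_
    intro x hx
    rw [hφ, spectrum_conj_diagonal] at hx
    obtain ⟨i, rfl⟩ := hx
    exact (hp i).symm
  rw [← hφ, h1, cfc_polynomial p (φ d) (by rw [hφ]; exact hsa), Polynomial.aeval_algHom_apply, hφ]
  congr 3
  funext i
  rw [← hp i]
  congr 1
  simp

/-- `g(L_ρ,R_ρ)` multiplies the `(i,j)` entry by `g(d_i,d_j)` in any basis diagonalizing `ρ`. -/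
theorem funLR_conj_diagonal (U : unitary (Matrix n n ℂ)) (d : n → ℝ) (g : ℝ → ℝ → ℝ)
    (X : Matrix n n ℂ) :
    funLR g ((U : Matrix n n ℂ) * diagonal (fun i => (d i : ℂ)) * (U : Matrix n n ℂ)ᴴ) X =
      (U : Matrix n n ℂ) * (Matrix.of fun i j => (g (d i) (d j) : ℂ) *
        ((U : Matrix n n ℂ)ᴴ * X * (U : Matrix n n ℂ)) i j) * (U : Matrix n n ℂ)ᴴ := by
  have hS : (Matrix.finite_real_spectrum (A :=
      (U : Matrix n n ℂ) * diagonal (fun i => (d i : ℂ)) * (U : Matrix n n ℂ)ᴴ)).toFinset =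
      Finset.univ.image d := by
    ext x
    rw [Set.Finite.mem_toFinset, spectrum_conj_diagonal]
    simp
  unfold funLR
  rw [hS]
  have key : ∀ x y : ℝ, ∀ Y : Matrix n n ℂ,
      (((U : Matrix n n ℂ) * diagonal (fun i => (((if d i = x then (1 : ℝ) else 0) : ℝ) : ℂ)) *
        (U : Matrix n n ℂ)ᴴ) * (Y *
      ((U : Matrix n n ℂ) * diagonal (fun i => (((if d i = y then (1 : ℝ) else 0) : ℝ) : ℂ)) *
        (U : Matrix n n ℂ)ᴴ))) =
      (U : Matrix n n ℂ) * (diagonal (fun i => (((if d i = x then (1 : ℝ) else 0) : ℝ) : ℂ)) *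
       ((U : Matrix n n ℂ)ᴴ * Y * (U : Matrix n n ℂ)) *
        diagonal (fun i => (((if d i = y then (1 : ℝ) else 0) : ℝ) : ℂ))) *
        (U : Matrix n n ℂ)ᴴ := by
    intro x y Y
    simp only [Matrix.mul_assoc]
  simp only [LinearMap.sum_apply, LinearMap.smul_apply, LinearMap.comp_apply,
    LinearMap.mulLeft_apply, LinearMap.mulRight_apply, spectralProj, cfc_conj_diagonal, key]
  have hM : (Matrix.of fun i j => (g (d i) (d j) : ℂ) *
        ((U : Matrix n n ℂ)ᴴ * X * (U : Matrix n n ℂ)) i j) =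
      ∑ x ∈ Finset.univ.image d, ∑ y ∈ Finset.univ.image d, (g x y : ℂ) •
        (diagonal (fun i => (((if d i = x then (1 : ℝ) else 0) : ℝ) : ℂ)) *
          ((U : Matrix n n ℂ)ᴴ * X * (U : Matrix n n ℂ)) *
          diagonal (fun i => (((if d i = y then (1 : ℝ) else 0) : ℝ) : ℂ))) := by
    ext i j
    simp only [Matrix.sum_apply, Matrix.smul_apply, diagonal_mul, mul_diagonal, of_apply,
      smul_eq_mul]
    rw [Finset.sum_eq_single (d i), Finset.sum_eq_single (d j)]
    · simp
    · intro y _ hy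
      simp [hy.symm]
    · intro h
      exact absurd (Finset.mem_image_of_mem d (Finset.mem_univ j)) h
    · intro x _ hx
      simp [hx.symm]
    · intro h
      exact absurd (Finset.mem_image_of_mem d (Finset.mem_univ i)) h
  rw [hM]
  simp only [Matrix.mul_sum, Matrix.sum_mul, Matrix.mul_smul, Matrix.smul_mul]

theorem trace_funLR_conj_diagonal (U : unitary (Matrix n n ℂ)) (d : n → ℝ) (g : ℝ → ℝ → ℝ)
    (X : Matrix n n ℂ) :
    (Xᴴ * funLR g
      ((U : Matrix n n ℂ) * diagonal (fun i => (d i : ℂ)) * (U : Matrix n n ℂ)ᴴ) X).trace =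
    ((∑ i, ∑ j, g (d i) (d j) *
      Complex.normSq (((U : Matrix n n ℂ)ᴴ * X * (U : Matrix n n ℂ)) i j) : ℝ) : ℂ) := by
  rw [funLR_conj_diagonal, ← Matrix.mul_assoc, Matrix.trace_mul_comm, ← Matrix.mul_assoc,
    ← Matrix.mul_assoc]
  have : (U : Matrix n n ℂ)ᴴ * Xᴴ * (U : Matrix n n ℂ) =
      ((U : Matrix n n ℂ)ᴴ * X * (U : Matrix n n ℂ))ᴴ := by
    simp [conjTranspose_mul, Matrix.mul_assoc]
  rw [this]
  generalize (U : Matrix n n ℂ)ᴴ * X * (U : Matrix n n ℂ) = Y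
  simp only [trace, diag_apply, Matrix.mul_apply, conjTranspose_apply, of_apply]
  rw [Finset.sum_comm]
  push_cast
  refine Finset.sum_congr rfl fun i _ => Finset.sum_congr rfl fun j _ => ?_
  rw [Complex.normSq_eq_conj_mul_self]
  simp only [RCLike.star_def]
  ring

theorem exists_conj_diagonal {ρ : Matrix n n ℂ} (hρ : ρ.IsHermitian) :
    ∃ U : unitary (Matrix n n ℂ), ρ = (U : Matrix n n ℂ) *
      diagonal (fun i => (hρ.eigenvalues i : ℂ)) * (U : Matrix n n ℂ)ᴴ :=
  ⟨hρ.eigenvectorUnitary, hρ.spectral_theorem⟩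

/-- Continuity in `ρ` of the quadratic form `Tr X* g(L_ρ,R_ρ) X` for continuous `g`. -/
theorem continuousOn_trace_funLR {g : ℝ → ℝ → ℝ} (hg : Continuous fun p : ℝ × ℝ => g p.1 p.2)
    (X : Matrix n n ℂ) :
    ContinuousOn (fun ρ : Matrix n n ℂ => (Xᴴ * funLR g ρ X).trace.re)
      {ρ | ρ.IsHermitian} := by
  let F : Matrix n n ℂ × Matrix n n ℂ → ℝ := fun q =>
    ∑ i, ∑ j, g ((q.1ᴴ * q.2 * q.1) i i).re ((q.1ᴴ * q.2 * q.1) j j).re *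
      Complex.normSq ((q.1ᴴ * X * q.1) i j)
  have hF : Continuous F := by
    refine continuous_finsetSum _ fun i _ => continuous_finsetSum _ fun j _ => ?_
    refine Continuous.mul (hg.comp (f := fun q : Matrix n n ℂ × Matrix n n ℂ =>
      (((q.1ᴴ * q.2 * q.1) i i).re, ((q.1ᴴ * q.2 * q.1) j j).re)) ?_) ?_
    · fun_prop
    · exact Complex.continuous_normSq.comp (by fun_prop)
  let C : Set (Matrix n n ℂ × Matrix n n ℂ) :=
    {q | q.1ᴴ * q.1 = 1 ∧ q.1 * q.1ᴴ = 1 ∧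
      q.1ᴴ * q.2 * q.1 = diagonal fun i => (((q.1ᴴ * q.2 * q.1) i i).re : ℂ)}
  have hC : IsClosed C := by
    refine (isClosed_eq (by fun_prop) (by fun_prop)).inter
      ((isClosed_eq (by fun_prop) (by fun_prop)).inter (isClosed_eq (by fun_prop) ?_))
    refine Continuous.matrix_diagonal ?_
    fun_prop
  have hval : ∀ q ∈ C, (Xᴴ * funLR g q.2 X).trace.re = F q := by
    rintro ⟨V, ρ⟩ ⟨h1, h2, h3⟩
    dsimp only at h1 h2 h3
    have h4 := trace_funLR_conj_diagonal (⟨V, h1, h2⟩ : unitary (Matrix n n ℂ))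
      (fun i => ((Vᴴ * ρ * V) i i).re) g X
    dsimp only at h4
    rw [← h3] at h4
    have h5 : V * (Vᴴ * ρ * V) * Vᴴ = ρ := by
      calc V * (Vᴴ * ρ * V) * Vᴴ = (V * Vᴴ) * ρ * (V * Vᴴ) := by simp only [Matrix.mul_assoc]
        _ = ρ := by rw [h2]; simp
    rw [h5] at h4
    dsimp only
    rw [h4, Complex.ofReal_re]
  have hex : ∀ ρ : Matrix n n ℂ, ρ.IsHermitian → ∃ V, (V, ρ) ∈ C := by
    intro ρ hρ
    obtain ⟨U, hU⟩ := exists_conj_diagonal hρ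
    have h1 : (U : Matrix n n ℂ)ᴴ * (U : Matrix n n ℂ) = 1 := U.2.1
    have h2 : (U : Matrix n n ℂ) * (U : Matrix n n ℂ)ᴴ = 1 := U.2.2
    refine ⟨U, h1, h2, ?_⟩
    have h3 : (U : Matrix n n ℂ)ᴴ * ρ * (U : Matrix n n ℂ) =
        diagonal (fun i => (hρ.eigenvalues i : ℂ)) := by
      conv_lhs => rw [hU]
      calc _ = ((U : Matrix n n ℂ)ᴴ * (U : Matrix n n ℂ)) *
            diagonal (fun i => (hρ.eigenvalues i : ℂ)) *
            ((U : Matrix n n ℂ)ᴴ * (U : Matrix n n ℂ)) := by simp only [Matrix.mul_assoc]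
        _ = _ := by rw [h1]; simp
    dsimp only
    rw [h3]
    congr 1
    funext i
    simp
  have hcpt : IsCompact {V : Matrix n n ℂ | ∀ i j, V i j ∈ Metric.closedBall (0 : ℂ) 1} := by
    have := isCompact_univ_pi fun _ : n => isCompact_univ_pi fun _ : n =>
      isCompact_closedBall (0 : ℂ) 1
    have he : {V : Matrix n n ℂ | ∀ i j, V i j ∈ Metric.closedBall (0 : ℂ) 1} =
        (Set.univ.pi fun _ : n => Set.univ.pi fun _ : n => Metric.closedBall (0 : ℂ) 1) := by
      ext V
      exact ⟨fun h i _ j _ => h i j, fun h i j => h i trivial j trivial⟩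
    rw [he]
    exact this
  choose! V hV using hex
  intro ρ hρ
  unfold ContinuousWithinAt
  rw [tendsto_iff_ultrafilter]
  intro 𝒰 h𝒰
  have hH : ∀ᶠ σ in (𝒰 : Filter (Matrix n n ℂ)), σ.IsHermitian :=
    h𝒰 self_mem_nhdsWithin
  have hid : Tendsto (fun σ : Matrix n n ℂ => σ) 𝒰 (𝓝 ρ) := h𝒰.trans nhdsWithin_le_nhds
  obtain ⟨W, -, hW⟩ := hcpt.ultrafilter_le_nhds (𝒰.map V) (by
    rw [le_principal_iff]
    show ∀ᶠ σ in (𝒰 : Filter (Matrix n n ℂ)), _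
    filter_upwards [hH] with σ hσ i j
    rw [mem_closedBall_zero_iff]
    exact entry_norm_bound_of_unitary (𝕜 := ℂ) ⟨(hV σ hσ).1, (hV σ hσ).2.1⟩ i j)
  have hW' : Tendsto V 𝒰 (𝓝 W) := hW
  have hpair : Tendsto (fun σ => (V σ, σ)) 𝒰 (𝓝 (W, ρ)) := hW'.prodMk_nhds hid
  have hmem : (W, ρ) ∈ C := hC.mem_of_tendsto hpair (hH.mono fun σ hσ => hV σ hσ)
  have hlim : Tendsto (fun σ => F (V σ, σ)) 𝒰 (𝓝 (F (W, ρ))) := (hF.tendsto _).comp hpair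
  rw [← hval _ hmem] at hlim
  exact hlim.congr' (hH.mono fun σ hσ => (hval _ (hV σ hσ)).symm)

theorem skewInformationManifold_eq {f : ℝ → ℝ} (hf : IsFop f) {ρ : Matrix n n ℂ} (hρ : ρ.PosDef)
    (A : Matrix n n ℂ) :
    skewInformationManifold f ρ A =
      valueAtZero f / 2 * (Aᴴ * funLR (cHat f) ρ A).trace.re := by
  unfold skewInformationManifold metricK
  congr 2
  obtain ⟨U, hU⟩ := exists_conj_diagonal hρ.1
  have hd : ∀ i, 0 < hρ.1.eigenvalues i := hρ.eigenvalues_pos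
  set d := hρ.1.eigenvalues
  have h1 : (U : Matrix n n ℂ)ᴴ * (U : Matrix n n ℂ) = 1 := U.2.1
  have hc : (U : Matrix n n ℂ)ᴴ * (Complex.I • ⁅ρ, A⁆) * (U : Matrix n n ℂ) =
      Complex.I • (diagonal (fun i => (d i : ℂ)) * ((U : Matrix n n ℂ)ᴴ * A * (U : Matrix n n ℂ)) -
        ((U : Matrix n n ℂ)ᴴ * A * (U : Matrix n n ℂ)) * diagonal (fun i => (d i : ℂ))) := by
    rw [Matrix.mul_smul, Matrix.smul_mul, Ring.lie_def, Matrix.mul_sub, Matrix.sub_mul]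
    congr 2
    · conv_lhs => rw [hU]
      simp only [← Matrix.mul_assoc, h1, Matrix.one_mul]
    · conv_lhs => rw [hU]
      simp only [Matrix.mul_assoc, h1, Matrix.mul_one]
  have e1 := trace_funLR_conj_diagonal U d (morozovaChentsov f) (Complex.I • ⁅ρ, A⁆)
  have e2 := trace_funLR_conj_diagonal U d (cHat f) A
  rw [← hU] at e1 e2
  rw [e1, e2, hc]
  congr 1
  refine Finset.sum_congr rfl fun i _ => Finset.sum_congr rfl fun j _ => ?_
  rw [← cHat_eq hf (hd i) (hd j)]
  generalize (U : Matrix n n ℂ)ᴴ * A * (U : Matrix n n ℂ) = Y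
  have : (Complex.I • (diagonal (fun i => (d i : ℂ)) * Y - Y * diagonal (fun i => (d i : ℂ)))) i j
      = Complex.I * ((d i - d j : ℝ) : ℂ) * Y i j := by
    simp only [Matrix.smul_apply, Matrix.sub_apply, diagonal_mul, mul_diagonal, smul_eq_mul]
    push_cast
    ring
  rw [this]
  simp only [map_mul, Complex.normSq_I, Complex.normSq_ofReal]
  ring

theorem mem_closure_stateManifold {ρ : Matrix n n ℂ} (hρ : IsDensity ρ) :
    ρ ∈ closure (stateManifold n) := by
  have hn : Nonempty n := by
    by_contra h
    rw [not_nonempty_iff] at h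
    have := hρ.2
    simp [Matrix.trace] at this
  have hN : (0 : ℝ) < Fintype.card n := by exact_mod_cast Fintype.card_pos
  let γ : ℝ → Matrix n n ℂ := fun t => (1 - t) • ρ + (t / Fintype.card n) • (1 : Matrix n n ℂ)
  have hγ : Continuous γ := by fun_prop
  have hlim : Tendsto γ (𝓝[>] 0) (𝓝 ρ) := by
    have := (hγ.tendsto 0).mono_left (nhdsWithin_le_nhds (s := Set.Ioi 0))
    simpa [γ] using this
  refine mem_closure_of_tendsto hlim ?_
  filter_upwards [Ioo_mem_nhdsGT (zero_lt_one (α := ℝ))] with t ht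
  refine ⟨?_, ?_⟩
  · have h1 : ((1 - t) • ρ).PosSemidef := hρ.1.smul (sub_nonneg.mpr ht.2.le)
    have h2 : ((t / Fintype.card n) • (1 : Matrix n n ℂ)).PosDef :=
      Matrix.PosDef.one.smul (div_pos ht.1 hN)
    exact Matrix.PosDef.posSemidef_add h1 h2
  · simp only [γ, trace_add, trace_smul, hρ.2, trace_one]
    have : (Fintype.card n : ℂ) ≠ 0 := by exact_mod_cast hN.ne'
    simp only [Complex.real_smul]
    push_cast
    field_simp
    ring

/-- `I_ρ^c(A) = (m(c)/2) Tr A* ĉ(L_ρ,R_ρ) A`, where `ĉ` extends `(x-y)² c(x,y)`; in particular the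
limit defining the extension exists. -/
theorem tendsto_skewInformationManifold {f : ℝ → ℝ} (hf : IsFop f) (hreg : RegularAtZero f)
    {ρ : Matrix n n ℂ} (hρ : IsDensity ρ) (A : Matrix n n ℂ) :
    Tendsto (fun σ => skewInformationManifold f σ A) (𝓝[stateManifold n] ρ)
      (𝓝 (valueAtZero f / 2 * (Aᴴ * funLR (cHat f) ρ A).trace.re)) := by
  have h1 := ((continuousOn_trace_funLR (hf.continuous_cHat hreg) A) ρ hρ.1.1).mono_left
    (nhdsWithin_mono ρ (show stateManifold n ⊆ {ρ | ρ.IsHermitian} from fun σ hσ => hσ.1.1))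
  refine (h1.const_mul (valueAtZero f / 2)).congr' ?_
  filter_upwards [self_mem_nhdsWithin] with σ hσ
  exact (skewInformationManifold_eq hf hσ.1 A).symm

theorem tendsto_skewInformation {f : ℝ → ℝ} (hf : IsFop f) (hreg : RegularAtZero f)
    {ρ : Matrix n n ℂ} (hρ : IsDensity ρ) (A : Matrix n n ℂ) :
    Tendsto (fun σ => skewInformationManifold f σ A) (𝓝[stateManifold n] ρ)
      (𝓝 (skewInformation f ρ A)) :=
  tendsto_extendFrom ⟨_, tendsto_skewInformationManifold hf hreg hρ A⟩

theorem skewInformation_eq {f : ℝ → ℝ} (hf : IsFop f) (hreg : RegularAtZero f)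
    {ρ : Matrix n n ℂ} (hρ : ρ ∈ stateManifold n) (A : Matrix n n ℂ) :
    skewInformation f ρ A = skewInformationManifold f ρ A := by
  refine extendFrom_eq (subset_closure hρ) ?_
  rw [skewInformationManifold_eq hf hρ.1]
  exact tendsto_skewInformationManifold hf hreg ⟨hρ.1.posSemidef, hρ.2⟩ A

end

end MetricSkew

/-! The partial trace sends `i[ρ, A ⊗ 1]` to `i[ρ₁, A]`, so on faithful states the inequality is
monotonicity of the metric `K^c` under the partial trace (`IsFop.metricK_partialTrace₂_le`). General
states follow by continuity, faithful states being dense.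

Monotonicity is proved by duality. The form of `c(L_ρ, R_ρ)` is dual to that of its inverse `R_ρ
f(L_ρ R_ρ⁻¹)` (`two_mul_re_trace_le`), and `B ↦ B ⊗ 1` is adjoint to the partial trace. It therefore
suffices that the inverse form at `(ρ, A ⊗ 1)` is at most the one at `(ρ₁, A)`
(`IsFop.trace_funLR_kronecker_one_le`).

With `Δ_ρ = L_ρ R_ρ⁻¹` that form is `⟨Aρ^{1/2}, f(Δ_ρ) Aρ^{1/2}⟩`. The map `V : Aρ₁^{1/2} ↦ (A ⊗
1)ρ^{1/2}` is an isometry with `V* Δ_ρ V = Δ_{ρ₁}`, so the claim becomes the operator Jensen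
inequality `V* f(Δ) V ≤ f(V* Δ V)` (`IsFop.jensen`). Operator monotonicity gives it once `Δ` is
dominated by an operator leaving the range of `V` invariant (`exists_posDef_block`). -/

namespace MetricSkew

/-! ### Operator Jensen inequality for isometries -/

section Jensen
variable {a b : Type*} [Fintype a] [DecidableEq a] [Fintype b] [DecidableEq b]

/-- A single polynomial interpolates `f` on both finite spectra, and an intertwining relation passes
to powers, hence to polynomials. No continuity of `f` is involved, and `V` may be rectangular. -/
theorem cfc_mul_eq_mul_cfc {A : Matrix a a ℂ} {B : Matrix b b ℂ} (hA : A.IsHermitian)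
    (hB : B.IsHermitian) {V : Matrix a b ℂ} (h : A * V = V * B) (f : ℝ → ℝ) :
    cfc f A * V = V * cfc f B := by
  let s : Finset ℝ := (Matrix.finite_real_spectrum (A := A)).toFinset ∪
    (Matrix.finite_real_spectrum (A := B)).toFinset
  let p : Polynomial ℝ := Lagrange.interpolate s id f
  have hp : ∀ x ∈ s, f x = p.eval x := fun x hx =>
    (Lagrange.eval_interpolate_at_node (v := id) f (Function.injective_id.injOn) hx).symm
  have h1 : cfc f A = Polynomial.aeval A p := by
    rw [← cfc_polynomial p A hA]
    exact cfc_congr fun x hx => hp x (by simp [s, hx])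
  have h2 : cfc f B = Polynomial.aeval B p := by
    rw [← cfc_polynomial p B hB]
    exact cfc_congr fun x hx => hp x (by simp [s, hx])
  rw [h1, h2]
  clear_value p
  have hpow : ∀ k : ℕ, A ^ k * V = V * B ^ k := by
    intro k
    induction k with
    | zero => simp
    | succ k ih => rw [pow_succ, Matrix.mul_assoc, h, ← Matrix.mul_assoc, ih, Matrix.mul_assoc,
        ← pow_succ]
  simp only [Polynomial.aeval_eq_sum_range, Matrix.sum_mul, Matrix.mul_sum, Matrix.smul_mul,
    Matrix.mul_smul, hpow]

/-- The permutation matrix of `e` is the intertwiner. This transports `OperatorMonotone`, stated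
over `Fin k`, to arbitrary finite index types. -/
theorem cfc_submatrix {A : Matrix a a ℂ} (hA : A.IsHermitian) (e : b ≃ a) (f : ℝ → ℝ) :
    cfc f (A.submatrix e e) = (cfc f A).submatrix e e := by
  have h := cfc_mul_eq_mul_cfc (hA.submatrix e) hA
    (V := (1 : Matrix a a ℂ).submatrix e id) (by
      rw [Matrix.submatrix_mul_equiv A 1 e e id]
      ext i j; simp [Matrix.mul_apply, Matrix.one_apply]) f
  have h1 := congrArg (fun M => M.submatrix id e) h
  ext i j
  have h2 := congrFun (congrFun h1 i) j
  simpa [Matrix.mul_apply, Matrix.one_apply] using h2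

theorem cfc_diagonal (d : a → ℝ) (g : ℝ → ℝ) :
    cfc g (diagonal fun i => (d i : ℂ)) = diagonal fun i => (g (d i) : ℂ) := by
  simpa using cfc_conj_diagonal (1 : unitary (Matrix a a ℂ)) d g

theorem OperatorMonotone.cfc_sub_posSemidef {f : ℝ → ℝ} (hf : OperatorMonotone f)
    {A B : Matrix a a ℂ} (hA : A.PosDef) (hB : B.PosDef) (hAB : (B - A).PosSemidef) :
    (cfc f B - cfc f A).PosSemidef := by
  let e := (Fintype.equivFin a).symm
  have h := hf _ (A.submatrix e e) (B.submatrix e e) (hA.submatrix e.injective)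
    (hB.submatrix e.injective) (hAB.submatrix e)
  rw [cfc_submatrix hA.1, cfc_submatrix hB.1] at h
  exact (Matrix.posSemidef_submatrix_equiv e).mp h

theorem star_dotProduct_diagonal_mulVec (d : a → ℝ) (v : a → ℂ) :
    star v ⬝ᵥ (diagonal (fun i => (d i : ℂ)) *ᵥ v) =
      ((∑ i, d i * Complex.normSq (v i) : ℝ) : ℂ) := by
  simp only [dotProduct, mulVec_diagonal, Pi.star_apply]
  push_cast
  refine Finset.sum_congr rfl fun i _ => ?_
  rw [Complex.normSq_eq_conj_mul_self]
  simp only [RCLike.star_def]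
  ring

theorem star_dotProduct_conj_mulVec {a b : Type*} [Fintype a] [Fintype b] (V : Matrix a b ℂ) (M : Matrix a a ℂ) (y : b → ℂ) :
    star y ⬝ᵥ ((Vᴴ * M * V) *ᵥ y) = star (V *ᵥ y) ⬝ᵥ (M *ᵥ (V *ᵥ y)) := by
  rw [star_mulVec, ← Matrix.mulVec_mulVec, ← Matrix.mulVec_mulVec, dotProduct_mulVec _ Vᴴ]

theorem eq_zero_of_star_dotProduct_mulVec {M : Matrix b b ℂ}
    (h : ∀ y, star y ⬝ᵥ (M *ᵥ y) = 0) : M = 0 := by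
  have h0 : Matrix.toEuclideanLin M = 0 := by
    rw [← inner_map_self_eq_zero]
    intro y
    have := h y.ofLp
    rw [← inner_conj_symm, EuclideanSpace.inner_eq_star_dotProduct, dotProduct_comm]
    simp [Matrix.toEuclideanLin, this]
  simpa using h0

/-- Over `ℂ` a quadratic form determines its matrix. Hence the hypotheses of `IsFop.jensen` can be
scalar identities, the form in which trace computations deliver them. -/
theorem conj_diagonal_eq_diagonal {V : Matrix a b ℂ} {d : a → ℝ} {e : b → ℝ}
    (h : ∀ y : b → ℂ, ∑ i, d i * Complex.normSq ((V *ᵥ y) i) = ∑ j, e j * Complex.normSq (y j)) :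
    Vᴴ * diagonal (fun i => (d i : ℂ)) * V = diagonal fun j => (e j : ℂ) := by
  rw [← sub_eq_zero]
  refine eq_zero_of_star_dotProduct_mulVec fun y => ?_
  rw [sub_mulVec, dotProduct_sub, star_dotProduct_conj_mulVec, star_dotProduct_diagonal_mulVec,
    star_dotProduct_diagonal_mulVec, h, sub_self]

/-- A positive definite `D` is dominated by a positive definite `E` leaving the range of the
isometry `V` invariant and acting on it as `Vᴴ D V + ε`. -/
theorem exists_posDef_block {D : Matrix a a ℂ} (hD : D.PosDef) {V : Matrix a b ℂ}
    (hV : Vᴴ * V = 1) {ε : ℝ} (hε : 0 < ε) :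
    ∃ E : Matrix a a ℂ, E.PosDef ∧ (E - D).PosSemidef ∧
      E * V = V * (Vᴴ * D * V + (ε : ℂ) • (1 : Matrix b b ℂ)) := by
  let P : Matrix a a ℂ := V * Vᴴ
  let Q : Matrix a a ℂ := 1 - P
  have hP : Pᴴ = P := by simp [P]
  have hQ : Qᴴ = Q := by simp [Q, hP]
  have hPV : P * V = V := by simp [P, Matrix.mul_assoc, hV]
  have hQV : Q * V = 0 := by simp [Q, Matrix.sub_mul, hPV]
  have hPP : P * P = P := by
    show P * (V * Vᴴ) = V * Vᴴ
    rw [← Matrix.mul_assoc, hPV]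
  let s : ℝ := √ε
  have hs : 0 < s := Real.sqrt_pos.mpr hε
  have hss : (s : ℂ) * s = ε := by exact_mod_cast Real.mul_self_sqrt hε.le
  have hs0 : (s : ℂ) ≠ 0 := by exact_mod_cast hs.ne'
  -- Completing the square: `Gᴴ * G` contains `-PDQ - QDP`, so adding it to `D` cancels the
  -- off-diagonal blocks. The price is `ε P` on the range of `V` and `ε⁻¹ QDPDQ` on its complement.
  let G : Matrix a a ℂ := (s : ℂ) • P - ((s : ℂ)⁻¹) • (P * D * Q)
  let E : Matrix a a ℂ := P * D * P + (ε : ℂ) • P + Q * D * Q +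
    ((s : ℂ)⁻¹ * (s : ℂ)⁻¹) • (Q * D * P * D * Q)
  have hDh : Dᴴ = D := hD.1
  have hGH : Gᴴ = (s : ℂ) • P - ((s : ℂ)⁻¹) • (Q * D * P) := by
    simp [G, hP, hQ, hDh, conjTranspose_smul, Matrix.mul_assoc]
  have hED : E - D = Gᴴ * G := by
    have hDdec : D = P * D * P + P * D * Q + Q * D * P + Q * D * Q := by
      simp only [Q]; noncomm_ring
    have e1 : Gᴴ * G = ((s : ℂ) * s) • P - (P * D * Q) - (Q * D * P) +
        ((s : ℂ)⁻¹ * (s : ℂ)⁻¹) • (Q * D * P * D * Q) := by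
      have p1 : P * (P * D * Q) = P * D * Q := by simp only [← Matrix.mul_assoc, hPP]
      have p2 : Q * D * P * P = Q * D * P := by rw [Matrix.mul_assoc, hPP]
      have p3 : Q * D * P * (P * D * Q) = Q * D * P * D * Q := by
        simp only [← Matrix.mul_assoc]; rw [p2]
      rw [hGH]
      simp only [G, smul_sub, Matrix.sub_mul, Matrix.mul_sub, Matrix.smul_mul, Matrix.mul_smul, hPP, p1, p2,
        p3, smul_smul, mul_inv_cancel₀ hs0, inv_mul_cancel₀ hs0, one_smul]
      abel
    rw [e1, hss]
    have e2 : E = (ε : ℂ) • P - (P * D * Q) - (Q * D * P) +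
        ((s : ℂ)⁻¹ * (s : ℂ)⁻¹) • (Q * D * P * D * Q) +
        (P * D * P + P * D * Q + Q * D * P + Q * D * Q) := by
      simp only [E]; abel
    rw [← hDdec] at e2
    exact sub_eq_of_eq_add e2
  have hpsd : (E - D).PosSemidef := by rw [hED]; exact posSemidef_conjTranspose_mul_self G
  refine ⟨E, ?_, hpsd, ?_⟩
  · have : E = D + (E - D) := by abel
    rw [this]
    exact hD.add_posSemidef hpsd
  · have : E * V = P * D * V + (ε : ℂ) • V := by
      simp only [E, Matrix.add_mul, Matrix.smul_mul, Matrix.mul_assoc, hPV, hQV]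
      simp
    rw [this]
    simp [P, Matrix.mul_add, Matrix.mul_assoc]

/-- The operator Jensen inequality, in coordinates diagonalizing both operators. -/
theorem IsFop.jensen {f : ℝ → ℝ} (hf : IsFop f) {V : Matrix a b ℂ} {d : a → ℝ} {e : b → ℝ}
    (hd : ∀ i, 0 < d i) (he : ∀ j, 0 < e j)
    (hV : ∀ y : b → ℂ, ∑ i, Complex.normSq ((V *ᵥ y) i) = ∑ j, Complex.normSq (y j))
    (hVd : ∀ y : b → ℂ,
      ∑ i, d i * Complex.normSq ((V *ᵥ y) i) = ∑ j, e j * Complex.normSq (y j))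
    (y : b → ℂ) :
    ∑ i, f (d i) * Complex.normSq ((V *ᵥ y) i) ≤ ∑ j, f (e j) * Complex.normSq (y j) := by
  have hV1 : Vᴴ * V = 1 := by
    simpa using conj_diagonal_eq_diagonal (V := V) (d := fun _ => 1) (e := fun _ => 1)
      (by simpa using hV)
  have hV2 := conj_diagonal_eq_diagonal hVd
  have hD : (diagonal fun i => (d i : ℂ)).PosDef :=
    Matrix.PosDef.diagonal fun i => by simpa using hd i
  -- Compress `f(D) ≤ f(E)` by `V`: since `E` is intertwined by `V` with `diag(e + ε)`, the right
  -- side becomes `f(diag(e + ε))`. Continuity of `f` then removes `ε`.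
  have key : ∀ ε : ℝ, 0 < ε → ∑ i, f (d i) * Complex.normSq ((V *ᵥ y) i) ≤
      ∑ j, f (e j + ε) * Complex.normSq (y j) := by
    intro ε hε
    obtain ⟨E, hE, hED, hEV⟩ := exists_posDef_block hD hV1 hε
    have hB : Vᴴ * diagonal (fun i => (d i : ℂ)) * V + (ε : ℂ) • (1 : Matrix b b ℂ) =
        diagonal fun j => ((e j + ε : ℝ) : ℂ) := by
      rw [hV2, ← diagonal_one, ← diagonal_smul, diagonal_add]
      congr 1; funext j; simp
    rw [hB] at hEV
    have h1 := cfc_mul_eq_mul_cfc hE.1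
      (isHermitian_diagonal_of_self_adjoint _ (by ext j; simp)) hEV f
    have h2 := hf.operatorMonotone.cfc_sub_posSemidef hD hE hED
    have h3 := h2.conjTranspose_mul_mul_same V
    rw [Matrix.mul_sub, Matrix.sub_mul, Matrix.mul_assoc, h1, ← Matrix.mul_assoc, hV1,
      Matrix.one_mul, cfc_diagonal, cfc_diagonal] at h3
    have h4 := h3.dotProduct_mulVec_nonneg y
    rw [sub_mulVec, dotProduct_sub, star_dotProduct_conj_mulVec, star_dotProduct_diagonal_mulVec,
      star_dotProduct_diagonal_mulVec, sub_nonneg] at h4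
    exact_mod_cast h4
  have hlim : Tendsto (fun ε : ℝ => ∑ j, f (e j + ε) * Complex.normSq (y j)) (𝓝[>] 0)
      (𝓝 (∑ j, f (e j) * Complex.normSq (y j))) := by
    refine Tendsto.mono_left ?_ nhdsWithin_le_nhds
    refine tendsto_finsetSum _ fun j _ => Tendsto.mul_const _ ?_
    have h1 : Tendsto (fun ε : ℝ => e j + ε) (𝓝 0) (𝓝 (e j)) := by
      simpa using (continuous_const_add (e j)).tendsto 0
    exact (hf.continuousAt (he j)).tendsto.comp h1
  exact ge_of_tendsto hlim (by filter_upwards [self_mem_nhdsWithin] with ε hε using key ε hε)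

end Jensen

/-! ### Partial trace: positivity, duality with `B ↦ B ⊗ 1`, commutators -/

section PartialTrace
variable {m n : Type*} [Fintype n]

theorem partialTrace₂_eq_sum (X : Matrix (m × n) (m × n) ℂ) :
    partialTrace₂ X = ∑ k, X.submatrix (fun i => (i, k)) (fun i => (i, k)) := by
  ext i j
  simp [partialTrace₂, Matrix.sum_apply]

theorem partialTrace₂_conjTranspose (X : Matrix (m × n) (m × n) ℂ) :
    partialTrace₂ Xᴴ = (partialTrace₂ X)ᴴ := by
  ext i j
  simp [partialTrace₂]

theorem continuous_partialTrace₂ :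
    Continuous (partialTrace₂ : Matrix (m × n) (m × n) ℂ → Matrix m m ℂ) := by
  refine continuous_matrix fun i j => ?_
  simp only [partialTrace₂, of_apply]
  fun_prop

theorem partialTrace₂_posSemidef {X : Matrix (m × n) (m × n) ℂ} (hX : X.PosSemidef) :
    (partialTrace₂ X).PosSemidef := by
  rw [partialTrace₂_eq_sum]
  exact posSemidef_sum _ fun k _ => hX.submatrix _

theorem partialTrace₂_posDef [Nonempty n] {X : Matrix (m × n) (m × n) ℂ} (hX : X.PosDef) :
    (partialTrace₂ X).PosDef := by
  classical
  -- One diagonal block supplies strict positivity; the remaining ones only need to be semidefinite.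
  obtain ⟨k₀⟩ := ‹Nonempty n›
  rw [partialTrace₂_eq_sum, ← Finset.add_sum_erase _ _ (Finset.mem_univ k₀)]
  exact (hX.submatrix fun i j h => (Prod.ext_iff.mp h).1).add_posSemidef
    (posSemidef_sum _ fun k _ => hX.posSemidef.submatrix _)

variable [Fintype m] [DecidableEq n]

theorem trace_mul_kronecker_one (X : Matrix (m × n) (m × n) ℂ) (B : Matrix m m ℂ) :
    (X * (B ⊗ₖ (1 : Matrix n n ℂ))).trace = (partialTrace₂ X * B).trace := by
  simp only [trace, diag_apply, Matrix.mul_apply, partialTrace₂, of_apply, kronecker_apply,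
    Fintype.sum_prod_type, one_apply, mul_ite, mul_one, mul_zero, Finset.sum_ite_eq',
    Finset.mem_univ, if_true, Finset.sum_mul]
  refine Finset.sum_congr rfl fun i _ => ?_
  rw [Finset.sum_comm]

theorem trace_partialTrace₂ [DecidableEq m] (X : Matrix (m × n) (m × n) ℂ) :
    (partialTrace₂ X).trace = X.trace := by
  simpa using (trace_mul_kronecker_one X 1).symm

/-- The partial trace commutes with left and right multiplication by `B ⊗ 1`. This is what reduces
skew information to the metric. -/
theorem partialTrace₂_lie (X : Matrix (m × n) (m × n) ℂ) (B : Matrix m m ℂ) :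
    partialTrace₂ (Complex.I • ⁅X, B ⊗ₖ (1 : Matrix n n ℂ)⁆) =
      Complex.I • ⁅partialTrace₂ X, B⁆ := by
  ext i j
  simp only [partialTrace₂, Ring.lie_def, of_apply, Matrix.smul_apply, Matrix.sub_apply,
    Matrix.mul_apply,
    kronecker_apply, Fintype.sum_prod_type, one_apply, mul_ite, mul_one, mul_zero, ite_mul,
    zero_mul, Finset.sum_ite_eq', Finset.sum_ite_eq, Finset.mem_univ, if_true, Finset.sum_mul,
    Finset.mul_sum, smul_eq_mul, Finset.sum_sub_distrib, mul_sub]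
  congr 1 <;> exact Finset.sum_comm

end PartialTrace

/-! ### Calculus of `L_ρ` and `R_ρ`: coordinate functions, inverses, duality -/

section
variable {n : Type*} [Fintype n] [DecidableEq n]

theorem funLR_snd {ρ : Matrix n n ℂ} (hρ : ρ.IsHermitian) (X : Matrix n n ℂ) :
    funLR (fun _ y => y) ρ X = X * ρ := by
  obtain ⟨U, hU⟩ := exists_conj_diagonal hρ
  have h2 : (U : Matrix n n ℂ) * (U : Matrix n n ℂ)ᴴ = 1 := U.2.2
  generalize hρ.eigenvalues = d at hU
  subst hU
  rw [funLR_conj_diagonal]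
  have : (Matrix.of fun i j => (d j : ℂ) *
      ((U : Matrix n n ℂ)ᴴ * X * (U : Matrix n n ℂ)) i j) =
      (U : Matrix n n ℂ)ᴴ * X * (U : Matrix n n ℂ) * diagonal fun j => (d j : ℂ) := by
    ext i j
    rw [mul_diagonal, of_apply, mul_comm]
  rw [this]
  simp only [← Matrix.mul_assoc, h2, Matrix.one_mul]

theorem funLR_fst {ρ : Matrix n n ℂ} (hρ : ρ.IsHermitian) (X : Matrix n n ℂ) :
    funLR (fun x _ => x) ρ X = ρ * X := by
  obtain ⟨U, hU⟩ := exists_conj_diagonal hρ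
  have h2 : (U : Matrix n n ℂ) * (U : Matrix n n ℂ)ᴴ = 1 := U.2.2
  generalize hρ.eigenvalues = d at hU
  subst hU
  rw [funLR_conj_diagonal]
  have : (Matrix.of fun i j => (d i : ℂ) *
      ((U : Matrix n n ℂ)ᴴ * X * (U : Matrix n n ℂ)) i j) =
      (diagonal fun j => (d j : ℂ)) * ((U : Matrix n n ℂ)ᴴ * X * (U : Matrix n n ℂ)) := by
    ext i j
    rw [diagonal_mul, of_apply]
  rw [this]
  simp only [Matrix.mul_assoc, h2, Matrix.mul_one]

theorem funLR_comp_of_mul_eq_one {ρ : Matrix n n ℂ} (hρ : ρ.PosDef) {g h : ℝ → ℝ → ℝ}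
    (hgh : ∀ x y, 0 < x → 0 < y → g x y * h x y = 1) (X : Matrix n n ℂ) :
    funLR g ρ (funLR h ρ X) = X := by
  obtain ⟨U, hU⟩ := exists_conj_diagonal hρ.1
  have hd : ∀ i, 0 < hρ.1.eigenvalues i := hρ.eigenvalues_pos
  have h1 : (U : Matrix n n ℂ)ᴴ * (U : Matrix n n ℂ) = 1 := U.2.1
  have h2 : (U : Matrix n n ℂ) * (U : Matrix n n ℂ)ᴴ = 1 := U.2.2
  generalize hρ.1.eigenvalues = d at hU hd
  clear hρ
  subst hU
  rw [funLR_conj_diagonal, funLR_conj_diagonal]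
  have h3 : ∀ Y : Matrix n n ℂ, (U : Matrix n n ℂ)ᴴ * ((U : Matrix n n ℂ) * Y *
      (U : Matrix n n ℂ)ᴴ) * (U : Matrix n n ℂ) = Y := by
    intro Y
    rw [← Matrix.mul_assoc, ← Matrix.mul_assoc, h1, Matrix.one_mul, Matrix.mul_assoc, h1,
      Matrix.mul_one]
  rw [h3]
  have h4 : (Matrix.of fun i j => (g (d i) (d j) : ℂ) * (Matrix.of fun i j =>
      (h (d i) (d j) : ℂ) * ((U : Matrix n n ℂ)ᴴ * X * (U : Matrix n n ℂ)) i j) i j) =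
      (U : Matrix n n ℂ)ᴴ * X * (U : Matrix n n ℂ) := by
    ext i j
    have : (g (d i) (d j) : ℂ) * (h (d i) (d j) : ℂ) = 1 := by
      exact_mod_cast hgh _ _ (hd i) (hd j)
    simp only [of_apply]
    rw [← mul_assoc, this, one_mul]
  rw [h4, ← Matrix.mul_assoc, ← Matrix.mul_assoc, h2, Matrix.one_mul, Matrix.mul_assoc, h2,
    Matrix.mul_one]

/-- In an eigenbasis of `ρ` this is the entrywise inequality `2pq ≤ t⁻¹p² + tq²` for real and
imaginary parts. Equality holds at `B = funLR h ρ X`, which makes the two forms Legendre dual. -/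
theorem two_mul_re_trace_le {ρ : Matrix n n ℂ} (hρ : ρ.PosDef) {g h : ℝ → ℝ → ℝ}
    (hg : ∀ x y, 0 < x → 0 < y → 0 < g x y)
    (hgh : ∀ x y, 0 < x → 0 < y → g x y * h x y = 1) (X B : Matrix n n ℂ) :
    2 * (Xᴴ * B).trace.re ≤ (Xᴴ * funLR h ρ X).trace.re + (Bᴴ * funLR g ρ B).trace.re := by
  obtain ⟨U, hU⟩ := exists_conj_diagonal hρ.1
  have hd : ∀ i, 0 < hρ.1.eigenvalues i := hρ.eigenvalues_pos
  have h2 : (U : Matrix n n ℂ) * (U : Matrix n n ℂ)ᴴ = 1 := U.2.2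
  generalize hρ.1.eigenvalues = d at hU hd
  clear hρ
  subst hU
  rw [trace_funLR_conj_diagonal, trace_funLR_conj_diagonal, Complex.ofReal_re, Complex.ofReal_re]
  have h3 : (Xᴴ * B).trace = (((U : Matrix n n ℂ)ᴴ * X * (U : Matrix n n ℂ))ᴴ *
      ((U : Matrix n n ℂ)ᴴ * B * (U : Matrix n n ℂ))).trace := by
    have : ((U : Matrix n n ℂ)ᴴ * X * (U : Matrix n n ℂ))ᴴ *
        ((U : Matrix n n ℂ)ᴴ * B * (U : Matrix n n ℂ)) =
        (U : Matrix n n ℂ)ᴴ * (Xᴴ * ((U : Matrix n n ℂ) * (U : Matrix n n ℂ)ᴴ) * B) *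
          (U : Matrix n n ℂ) := by
      simp only [conjTranspose_mul, conjTranspose_conjTranspose, Matrix.mul_assoc]
    rw [this, h2, Matrix.mul_one, Matrix.trace_mul_comm _ (U : Matrix n n ℂ), ← Matrix.mul_assoc, h2,
      Matrix.one_mul]
  rw [h3]
  generalize (U : Matrix n n ℂ)ᴴ * X * (U : Matrix n n ℂ) = Y
  generalize (U : Matrix n n ℂ)ᴴ * B * (U : Matrix n n ℂ) = C
  simp only [trace, diag_apply, Matrix.mul_apply, conjTranspose_apply, Complex.re_sum,
    Finset.mul_sum]
  rw [Finset.sum_comm, ← Finset.sum_add_distrib]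
  refine Finset.sum_le_sum fun i _ => ?_
  rw [← Finset.sum_add_distrib]
  refine Finset.sum_le_sum fun j _ => ?_
  have hg0 := hg _ _ (hd i) (hd j)
  have hh : h (d i) (d j) = (g (d i) (d j))⁻¹ := eq_inv_of_mul_eq_one_right (hgh _ _ (hd i) (hd j))
  rw [hh]
  generalize g (d i) (d j) = t at hg0
  have hre : (star (Y i j) * C i j).re = (Y i j).re * (C i j).re + (Y i j).im * (C i j).im := by
    simp [Complex.mul_re]
  rw [hre, Complex.normSq_apply, Complex.normSq_apply]
  have key : ∀ p q : ℝ, 2 * (p * q) ≤ t⁻¹ * (p * p) + t * (q * q) := by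
    intro p q
    have h5 : t⁻¹ * (p * p) + t * (q * q) - 2 * (p * q) = t⁻¹ * (p - t * q) ^ 2 := by
      field_simp
      ring
    have h6 : 0 ≤ t⁻¹ * (p - t * q) ^ 2 := by positivity
    linarith
  have k1 := key (Y i j).re (C i j).re
  have k2 := key (Y i j).im (C i j).im
  linarith

end

/-! ### Monotonicity of the metric under the partial trace -/

section
variable {m n : Type*} [Fintype m] [DecidableEq m] [Fintype n] [DecidableEq n]

/-- Jensen's inequality for `Δ_ρ = L_ρ R_ρ⁻¹`, whose eigenvalues are the ratios `d i / d j`. The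
weight `y` in `y f(x/y)` is absorbed into the vector `Aρ^{1/2}`. -/
theorem IsFop.trace_funLR_kronecker_one_le {f : ℝ → ℝ} (hf : IsFop f)
    {ρ : Matrix (m × n) (m × n) ℂ} (hρ : ρ.PosDef) (hσ : (partialTrace₂ ρ).PosDef)
    (A : Matrix m m ℂ) :
    ((A ⊗ₖ (1 : Matrix n n ℂ))ᴴ * funLR (fun x y => y * f (x * y⁻¹)) ρ
      (A ⊗ₖ (1 : Matrix n n ℂ))).trace.re ≤
    (Aᴴ * funLR (fun x y => y * f (x * y⁻¹)) (partialTrace₂ ρ) A).trace.re := by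
  obtain ⟨U, hU⟩ := exists_conj_diagonal hρ.1
  obtain ⟨W, hW⟩ := exists_conj_diagonal hσ.1
  have hd : ∀ i, 0 < hρ.1.eigenvalues i := hρ.eigenvalues_pos
  have he : ∀ i, 0 < hσ.1.eigenvalues i := hσ.eigenvalues_pos
  have hW1 : (W : Matrix m m ℂ)ᴴ * (W : Matrix m m ℂ) = 1 := W.2.1
  generalize hρ.1.eigenvalues = d at hU hd
  generalize hσ.1.eigenvalues = e at hW he
  have tρ := fun g X => trace_funLR_conj_diagonal U d g X
  have tσ := fun g X => trace_funLR_conj_diagonal W e g X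
  rw [← hU] at tρ
  rw [← hW] at tσ
  -- Both sides equal `Tr ρ₁ B*B`; this will make `V` an isometry.
  have q1 : ∀ B : Matrix m m ℂ, ∑ i, ∑ j, d j * Complex.normSq
      (((U : Matrix (m × n) (m × n) ℂ)ᴴ * (B ⊗ₖ (1 : Matrix n n ℂ)) *
        (U : Matrix (m × n) (m × n) ℂ)) i j) =
      ∑ k, ∑ l, e l * Complex.normSq (((W : Matrix m m ℂ)ᴴ * B * (W : Matrix m m ℂ)) k l) := by
    intro B
    have h1 := tρ (fun _ y => y) (B ⊗ₖ (1 : Matrix n n ℂ))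
    have h2 := tσ (fun _ y => y) B
    rw [funLR_snd hρ.1, ← Matrix.mul_assoc, Matrix.trace_mul_comm, conjTranspose_kronecker,
      conjTranspose_one, ← mul_kronecker_mul, Matrix.one_mul, trace_mul_kronecker_one] at h1
    rw [funLR_snd hσ.1, ← Matrix.mul_assoc, Matrix.trace_mul_comm, h1] at h2
    exact_mod_cast h2
  -- Both sides equal `Tr ρ₁ BB*`. Since `Δ` turns the weight `d j` into `d i`, this will give `V*
  -- Δ_ρ V = Δ_{ρ₁}`.
  have q2 : ∀ B : Matrix m m ℂ, ∑ i, ∑ j, d i * Complex.normSq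
      (((U : Matrix (m × n) (m × n) ℂ)ᴴ * (B ⊗ₖ (1 : Matrix n n ℂ)) *
        (U : Matrix (m × n) (m × n) ℂ)) i j) =
      ∑ k, ∑ l, e k * Complex.normSq (((W : Matrix m m ℂ)ᴴ * B * (W : Matrix m m ℂ)) k l) := by
    intro B
    have h1 := tρ (fun x _ => x) (B ⊗ₖ (1 : Matrix n n ℂ))
    have h2 := tσ (fun x _ => x) B
    rw [funLR_fst hρ.1, Matrix.trace_mul_comm, Matrix.mul_assoc, conjTranspose_kronecker,
      conjTranspose_one, ← mul_kronecker_mul, Matrix.one_mul, trace_mul_kronecker_one] at h1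
    rw [funLR_fst hσ.1, Matrix.trace_mul_comm, Matrix.mul_assoc, h1] at h2
    exact_mod_cast h2
  -- in the eigenbases, `A ρ₁^{1/2} ↦ (A ⊗ 1) ρ^{1/2}` is an isometry `V`
  let B : (m × m → ℂ) →ₗ[ℂ] Matrix m m ℂ :=
    { toFun := fun y => (W : Matrix m m ℂ) *
        (Matrix.of fun k l => ((√(e l))⁻¹ : ℂ) * y (k, l)) * (W : Matrix m m ℂ)ᴴ
      map_add' := fun y z => by
        rw [← Matrix.add_mul, ← Matrix.mul_add]
        congr 2; ext k l; simp [mul_add]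
      map_smul' := fun c y => by
        rw [RingHom.id_apply, ← Matrix.smul_mul, ← Matrix.mul_smul]
        congr 2; ext k l; simp [mul_left_comm] }
  let T : (m × m → ℂ) →ₗ[ℂ] ((m × n) × (m × n) → ℂ) :=
    { toFun := fun y p => (√(d p.2) : ℂ) * (((U : Matrix (m × n) (m × n) ℂ)ᴴ *
        (B y ⊗ₖ (1 : Matrix n n ℂ)) * (U : Matrix (m × n) (m × n) ℂ)) p.1 p.2)
      map_add' := fun y z => by
        funext p
        rw [map_add, add_kronecker, Matrix.mul_add, Matrix.add_mul, Matrix.add_apply, mul_add]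
        rfl
      map_smul' := fun c y => by
        funext p
        rw [map_smul, smul_kronecker, Matrix.mul_smul, Matrix.smul_mul, Matrix.smul_apply,
          smul_eq_mul, mul_left_comm]
        rfl }
  let V := LinearMap.toMatrix' T
  have hV : ∀ y p, Complex.normSq ((V *ᵥ y) p) = d p.2 * Complex.normSq
      (((U : Matrix (m × n) (m × n) ℂ)ᴴ * (B y ⊗ₖ (1 : Matrix n n ℂ)) *
        (U : Matrix (m × n) (m × n) ℂ)) p.1 p.2) := by
    intro y p
    have : V *ᵥ y = T y := LinearMap.toMatrix'_mulVec T y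
    rw [this]
    show Complex.normSq ((√(d p.2) : ℂ) * _) = _
    rw [Complex.normSq_mul, Complex.normSq_ofReal, Real.mul_self_sqrt (hd _).le]
  have hB : ∀ y k l, e l * Complex.normSq
      (((W : Matrix m m ℂ)ᴴ * B y * (W : Matrix m m ℂ)) k l) = Complex.normSq (y (k, l)) := by
    intro y k l
    have : (W : Matrix m m ℂ)ᴴ * B y * (W : Matrix m m ℂ) =
        Matrix.of fun k l => ((√(e l))⁻¹ : ℂ) * y (k, l) := by
      show (W : Matrix m m ℂ)ᴴ * (_ * _ * _) * (W : Matrix m m ℂ) = _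
      rw [← Matrix.mul_assoc, ← Matrix.mul_assoc, hW1, Matrix.one_mul, Matrix.mul_assoc, hW1,
        Matrix.mul_one]
    rw [this, of_apply, Complex.normSq_mul, Complex.normSq_inv, Complex.normSq_ofReal,
      Real.mul_self_sqrt (he _).le, ← mul_assoc, mul_inv_cancel₀ (he l).ne', one_mul]
  have hBA : ∃ y, B y = A := by
    have hW2 : (W : Matrix m m ℂ) * (W : Matrix m m ℂ)ᴴ = 1 := W.2.2
    refine ⟨fun p => (√(e p.2) : ℂ) *
      ((W : Matrix m m ℂ)ᴴ * A * (W : Matrix m m ℂ)) p.1 p.2, ?_⟩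
    have : (Matrix.of fun k l => ((√(e l))⁻¹ : ℂ) * ((√(e l) : ℂ) *
        ((W : Matrix m m ℂ)ᴴ * A * (W : Matrix m m ℂ)) k l)) =
        (W : Matrix m m ℂ)ᴴ * A * (W : Matrix m m ℂ) := by
      ext k l
      have h0 : (√(e l) : ℂ) ≠ 0 := by exact_mod_cast (Real.sqrt_pos.mpr (he l)).ne'
      rw [of_apply, ← mul_assoc, inv_mul_cancel₀ h0, one_mul]
    show (W : Matrix m m ℂ) * (Matrix.of fun k l => _) * (W : Matrix m m ℂ)ᴴ = A
    rw [this, ← Matrix.mul_assoc, ← Matrix.mul_assoc, hW2, Matrix.one_mul, Matrix.mul_assoc, hW2,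
      Matrix.mul_one]
  obtain ⟨y, rfl⟩ := hBA
  have hJ := hf.jensen (V := V) (d := fun p => d p.1 * (d p.2)⁻¹) (e := fun p => e p.1 * (e p.2)⁻¹)
    (fun p => mul_pos (hd _) (inv_pos.mpr (hd _))) (fun p => mul_pos (he _) (inv_pos.mpr (he _)))
    (fun y => by
      simp only [hV, Fintype.sum_prod_type (α₁ := m × n), Fintype.sum_prod_type (α₁ := m) (α₂ := m)]
      rw [q1]
      simp only [hB])
    (fun y => by
      have hc : ∀ s t u : ℝ, 0 < t → s * t⁻¹ * (t * u) = s * u := fun s t u ht => by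
        field_simp
      simp only [hV, ← hB, hc _ _ _ (hd _), hc _ _ _ (he _), Fintype.sum_prod_type (α₁ := m × n),
        Fintype.sum_prod_type (α₁ := m) (α₂ := m)]
      rw [q2]) y
  rw [tρ, tσ, Complex.ofReal_re, Complex.ofReal_re]
  simpa only [hV, ← hB, Fintype.sum_prod_type (α₁ := m × n) (α₂ := m × n),
    Fintype.sum_prod_type (α₁ := m) (α₂ := m), mul_left_comm, mul_assoc] using hJ

/-- The metric decreases under the partial trace. -/
theorem IsFop.metricK_partialTrace₂_le {f : ℝ → ℝ} (hf : IsFop f)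
    {ρ : Matrix (m × n) (m × n) ℂ} (hρ : ρ.PosDef) (hσ : (partialTrace₂ ρ).PosDef)
    (X : Matrix (m × n) (m × n) ℂ) :
    (metricK f (partialTrace₂ ρ) (partialTrace₂ X) (partialTrace₂ X)).re ≤
      (metricK f ρ X X).re := by
  have hg : ∀ x y : ℝ, 0 < x → 0 < y → 0 < y * f (x * y⁻¹) := fun x y hx hy =>
    mul_pos hy (hf.pos _ (by positivity))
  have hgh : ∀ x y : ℝ, 0 < x → 0 < y → y * f (x * y⁻¹) * morozovaChentsov f x y = 1 :=
    fun x y hx hy => mul_one_div_cancel (hg x y hx hy).ne'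
  unfold metricK
  set Z := partialTrace₂ X
  -- The optimal dual vector for `Z`: its inverse form at `ρ₁` equals `K = K_{ρ₁}(Z, Z)`, up to real
  -- parts. Testing `X` against `A ⊗ 1` gives `2K ≤ K_ρ(X, X) + K`.
  set A := funLR (morozovaChentsov f) (partialTrace₂ ρ) Z with hA
  have h1 := two_mul_re_trace_le hρ hg hgh X (A ⊗ₖ (1 : Matrix n n ℂ))
  have h2 := hf.trace_funLR_kronecker_one_le hρ hσ A
  rw [hA, funLR_comp_of_mul_eq_one hσ hgh, ← hA] at h2
  rw [trace_mul_kronecker_one, partialTrace₂_conjTranspose] at h1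
  have h3 : (Aᴴ * Z).trace.re = (Zᴴ * A).trace.re := by
    have : (Aᴴ * Z).trace = star (Zᴴ * A).trace := by
      rw [← trace_conjTranspose, conjTranspose_mul, conjTranspose_conjTranspose]
    rw [this]; simp
  change 2 * (Zᴴ * A).trace.re ≤ _ at h1
  linarith

/-! ### Skew information: faithful states, then all states by continuity -/

theorem IsFop.skewInformationManifold_partialTrace₂_le {f : ℝ → ℝ} (hf : IsFop f)
    (hreg : RegularAtZero f) {ρ : Matrix (m × n) (m × n) ℂ} (hρ : ρ.PosDef)
    (hσ : (partialTrace₂ ρ).PosDef) (A : Matrix m m ℂ) :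
    skewInformationManifold f (partialTrace₂ ρ) A ≤
      skewInformationManifold f ρ (A ⊗ₖ (1 : Matrix n n ℂ)) := by
  unfold skewInformationManifold
  rw [← partialTrace₂_lie]
  exact mul_le_mul_of_nonneg_left (hf.metricK_partialTrace₂_le hρ hσ _)
    (half_pos hreg).le

/-- Metric adjusted skew information does not increase under passage to a subsystem. -/
theorem IsFop.skewInformation_partialTrace₂_le {f : ℝ → ℝ} (hf : IsFop f)
    (hreg : RegularAtZero f) {ρ : Matrix (m × n) (m × n) ℂ} (hρ : IsDensity ρ)
    (A : Matrix m m ℂ) :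
    skewInformation f (partialTrace₂ ρ) A ≤ skewInformation f ρ (A ⊗ₖ (1 : Matrix n n ℂ)) := by
  -- Trace one excludes an empty index type; `partialTrace₂_posDef` needs this to keep faithful
  -- states faithful.
  have hn : Nonempty n := by
    by_contra h
    rw [not_nonempty_iff] at h
    have := hρ.2
    simp [Matrix.trace] at this
  have hσ : IsDensity (partialTrace₂ ρ) :=
    ⟨partialTrace₂_posSemidef hρ.1, (trace_partialTrace₂ ρ).trans hρ.2⟩
  have hmaps : ∀ τ ∈ stateManifold (m × n), partialTrace₂ τ ∈ stateManifold m :=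
    fun τ hτ => ⟨partialTrace₂_posDef hτ.1, (trace_partialTrace₂ τ).trans hτ.2⟩
  -- Density of faithful states makes this filter nontrivial, so the inequality survives in the
  -- limit. One approach `τ → ρ` serves both sides, since `partialTrace₂ τ` tends to `partialTrace₂
  -- ρ` through faithful states.
  have : (𝓝[stateManifold (m × n)] ρ).NeBot :=
    mem_closure_iff_nhdsWithin_neBot.mp (mem_closure_stateManifold hρ)
  have hlim : Tendsto partialTrace₂ (𝓝[stateManifold (m × n)] ρ)
      (𝓝[stateManifold m] (partialTrace₂ ρ)) :=
    continuous_partialTrace₂.continuousWithinAt.tendsto_nhdsWithin hmaps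
  refine le_of_tendsto_of_tendsto ((tendsto_skewInformation hf hreg hσ A).comp hlim)
    (tendsto_skewInformation hf hreg hρ (A ⊗ₖ (1 : Matrix n n ℂ))) ?_
  filter_upwards [self_mem_nhdsWithin] with τ hτ
  exact hf.skewInformationManifold_partialTrace₂_le hreg hτ.1 (hmaps τ hτ).1 A

end

end MetricSkew

theorem mainTheorem5 {m n : Type*} [Fintype m] [DecidableEq m] [Fintype n] [DecidableEq n]
    (f : ℝ → ℝ) (hf : MetricSkew.IsFop f) (hreg : MetricSkew.RegularAtZero f)
    (ρ : Matrix (m × n) (m × n) ℂ) (hρ : MetricSkew.IsDensity ρ)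
    (A : Matrix m m ℂ) (hA : A.IsHermitian) :
    MetricSkew.skewInformation f ρ (A ⊗ₖ (1 : Matrix n n ℂ)) ≥
      MetricSkew.skewInformation f (MetricSkew.partialTrace₂ ρ) A := by
  exact hf.skewInformation_partialTrace₂_le hreg hρ A
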